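/- A unit cube in $\mathbb{R}^n$ is an axis-parallel closed cube of side length $1$. An ($n$-dimensional) cross with centre $c\in\mathbb{R}^n$ is the union of the $2n+1$ unit cubes with centres $c$ and $c\pm e_i$ ($1\le i\le n$), that is, of the unit cube centred at $c$ and its reflections in all its faces. A tiling of $\mathbb{R}^n$ by crosses is a family of crosses that covers $\mathbb{R}^n$ and in which distinct crosses have disjoint interiors; it is identified with the set $\mathcal{T}\subset\mathbb{R}^n$ of the centres of its crosses. It is a $Z$-tiling if $\mathcal{T}\subset\mathbb{Z}^n$, and a lattice tiling if it consists of the translates of one cross by the vectors of a lattice (a discrete additive subgroup of $\mathbb{R}^n$ that spans $\mathbb{R}^n$), i.e. $\mathcal{T}=v+\Lambda$ for some $v\in\mathbb{R}^n$ and some lattice $\Lambda$. Theorem. Every $Z$-tiling $\mathcal{T}$ of $\mathbb{R}^5$ by crosses is a lattice tiling. In particular, if the origin belongs to $\mathcal{T}$, then $\mathcal{T}$ itself is a lattice in $\mathbb{R}^5$, and $W-Z\in\mathcal{T}$ for all $W,Z\in\mathcal{T}$. -/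

import Mathlib

/-- The closed axis-parallel unit cube in `ℝⁿ` with centre `c`. -/
def unitCube {n : ℕ} (c : EuclideanSpace ℝ (Fin n)) : Set (EuclideanSpace ℝ (Fin n)) :=
  {x | ∀ i, |x i - c i| ≤ 1 / 2}

/-- The `n`-dimensional cross with centre `c`: the unit cube centred at `c` together with its
reflections in all its `2n` faces, i.e. the unit cubes centred at `c + eᵢ` and `c - eᵢ`. -/
def cross {n : ℕ} (c : EuclideanSpace ℝ (Fin n)) : Set (EuclideanSpace ℝ (Fin n)) :=
  unitCube c ∪
    ⋃ i : Fin n, (unitCube (c + EuclideanSpace.single i 1) ∪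
      unitCube (c - EuclideanSpace.single i 1))

/-- `T` is the set of centres of a tiling of `ℝⁿ` by crosses: the crosses centred at the points
of `T` cover `ℝⁿ`, and distinct ones have disjoint interiors. -/
structure IsCrossTiling {n : ℕ} (T : Set (EuclideanSpace ℝ (Fin n))) : Prop where
  cover : ⋃ c ∈ T, cross c = Set.univ
  disjoint : T.Pairwise fun c d => Disjoint (interior (cross c)) (interior (cross d))

/-- A `Z`-tiling by crosses: a tiling in which all centres have integer coordinates. -/
structure IsCrossZTiling {n : ℕ} (T : Set (EuclideanSpace ℝ (Fin n))) : Prop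
    extends IsCrossTiling T where
  integral : ∀ c ∈ T, ∀ i, ∃ m : ℤ, c i = m

/-- The set `T` is a lattice in `ℝⁿ`: a discrete additive subgroup that spans `ℝⁿ` over `ℝ`. -/
def IsLatticeSet {n : ℕ} (T : Set (EuclideanSpace ℝ (Fin n))) : Prop :=
  ∃ L : Submodule ℤ (EuclideanSpace ℝ (Fin n)),
    (∃ _ : DiscreteTopology L, IsZLattice ℝ L) ∧ (L : Set (EuclideanSpace ℝ (Fin n))) = T

/-- `T` is the set of centres of a lattice tiling by crosses: the tiling consists of the translates
of a single one of its crosses (with centre `v`) by the vectors of a lattice `L`. -/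
def IsLatticeCrossTiling {n : ℕ} (T : Set (EuclideanSpace ℝ (Fin n))) : Prop :=
  IsCrossTiling T ∧ ∃ (v : EuclideanSpace ℝ (Fin n)) (L : Set (EuclideanSpace ℝ (Fin n))),
    IsLatticeSet L ∧ T = {x | ∃ l ∈ L, x = v + l}

/-! At integer points, a `Z`-tiling says that every `z` has exactly one of its 11 translates by
cross vectors in the set `S` of centres. Write this as A·1_S = 1, with A the sum of the group-ring
elements of the cross vectors. Raising A to a prime power q in characteristic q multiplies the cross
vectors by q (`sum_shift_pow_char`).

For q = 11, the number of cross vectors, this makes `S` periodic under 11ℤ⁵, so everything descends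
to (ℤ/11)⁵. For q = 2, a parity and averaging argument shows that the cross dilated by 2, hence by
every nonzero residue, also tiles with centres `S`.

The dilated tilings forbid two points of `S` from differing by k·eᵢ or k·(eᵢ ± eⱼ), i ≠ j, k ≠ 0. By
counting, `S` meets each axis-parallel line once, so it is the graph of a function f over the
direction e₀. Along any other axis f solves the toroidal 11-queens problem, all of whose solutions
are affine (`exists_slope_of_queens`, a finite search). The slopes are nonzero, which forces f to be
globally affine (`exists_affine_of_slopes`). Hence `S` is a coset of the kernel of a linear form
modulo 11, a lattice. -/

/-! ### Exhaustive search for toroidal queens -/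

/-- `v` may be placed `d, d + 1, …` columns after the entries of the list. -/
def queenFits (v : ℕ) : ℕ → List ℕ → Bool
  | _, [] => true
  | d, w :: p =>
    !(Nat.beq v w) && !(Nat.beq ((v + d) % 11) w) && !(Nat.beq ((w + d) % 11) v) &&
      queenFits v (d + 1) p

/-- Backtracking over the remaining columns, the newest column at the head of the list. The value
`true` certifies that every completed placement is linear in the column, not that one exists. -/
def queenSearch : ℕ → List ℕ → Bool
  | 0, p => (List.range 11).any fun c =>
      p == (List.range 11).reverse.map fun i => (c * i) % 11
  | n + 1, p => (List.range 11).all fun v => !(queenFits v 1 p) || queenSearch n (v :: p)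

theorem queenSearch_eq_true : queenSearch 10 [0] = true := by decide +kernel

/-! ### Frobenius in the group ring -/

/-- Let the group ring over `ZMod q` act on functions by translation, with A the sum of the `a i`.
Frobenius gives A^q as the sum of the `q • a i`. On the other hand A sends `f` to 1, and each of the
q - 1 further factors multiplies a constant by `card ι`. -/
theorem sum_shift_pow_char {G ι : Type*} [AddCommGroup G] [Fintype ι] (q : ℕ) [Fact q.Prime]
    (a : ι → G) (f : G → ZMod q) (h : ∀ x, ∑ i, f (x + a i) = 1) (x : G) :
    ∑ i, f (x + q • a i) = (Fintype.card ι : ZMod q) ^ (q - 1) := by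
  let shift : Multiplicative G →* Module.End (ZMod q) (G → ZMod q) :=
    { toFun := fun b => LinearMap.funLeft (ZMod q) (ZMod q) (· + b.toAdd)
      map_one' := by ext; simp [LinearMap.funLeft]
      map_mul' := fun b c => by
        ext g i
        simp only [LinearMap.funLeft, toAdd_mul, Module.End.mul_apply, LinearMap.coe_mk,
          AddHom.coe_mk, Function.comp_apply]
        congr 1; abel }
  let Φ := AddMonoidAlgebra.lift (ZMod q) (Module.End (ZMod q) (G → ZMod q)) G shift
  have hΦ : ∀ (b : ι → G) (g : G → ZMod q) (y : G),
      Φ (∑ i, AddMonoidAlgebra.single (b i) 1) g y = ∑ i, g (y + b i) := by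
    intro b g y
    simp [Φ, shift, LinearMap.funLeft]
  have : CharP (AddMonoidAlgebra (ZMod q) G) q :=
    charP_of_injective_algebraMap (algebraMap (ZMod q) _).injective q
  have hpow : (∑ i, AddMonoidAlgebra.single (a i) (1 : ZMod q)) ^ q =
      ∑ i, AddMonoidAlgebra.single (q • a i) (1 : ZMod q) := by
    rw [sum_pow_char q]
    simp [AddMonoidAlgebra.single_pow]
  rw [← hΦ, ← hpow, map_pow]
  have key : ∀ n : ℕ, (Φ (∑ i, AddMonoidAlgebra.single (a i) 1) ^ (n + 1)) f =
      fun _ => (Fintype.card ι : ZMod q) ^ n := by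
    intro n
    induction n with
    | zero => ext y; simp only [zero_add, pow_one, pow_zero]; rw [hΦ]; exact h y
    | succ n ih =>
      rw [pow_succ', Module.End.mul_apply, ih]
      ext y
      rw [hΦ]
      simp [pow_succ']
  have hq : 0 < q := (Fact.out : q.Prime).pos
  have := congrFun (key (q - 1)) x
  rwa [show q - 1 + 1 = q by omega] at this

/-! ### From the search to affine queen placements -/

def queenPrefix (g : ZMod 11 → ZMod 11) (k : ℕ) : List ℕ :=
  (List.range k).reverse.map fun i : ℕ => (g (i : ZMod 11)).val

theorem queenPrefix_succ (g : ZMod 11 → ZMod 11) (k : ℕ) :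
    queenPrefix g (k + 1) = (g (k : ZMod 11)).val :: queenPrefix g k := by
  simp [queenPrefix, List.range_succ]

theorem val_add_natCast_mod_ne {u v : ZMod 11} {d : ℕ} (h : u + d ≠ v) :
    (u.val + d) % 11 ≠ v.val := by
  intro H
  apply h
  have := congrArg (Nat.cast : ℕ → ZMod 11) H
  simpa using this

theorem queenFits_queenPrefix {g : ZMod 11 → ZMod 11}
    (hg : ∀ a b, a ≠ b → g a ≠ g b ∧ g a + a ≠ g b + b ∧ g a - a ≠ g b - b) (k : ℕ) :
    ∀ d, k + (d + 1) ≤ 11 →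
      queenFits (g ((k + d : ℕ) : ZMod 11)).val (d + 1) (queenPrefix g k) = true := by
  induction k with
  | zero => intros; simp [queenPrefix, queenFits]
  | succ k ih =>
    intro d hd
    have hne : ((k + (d + 1) : ℕ) : ZMod 11) ≠ (k : ZMod 11) := by
      rw [Ne, ZMod.natCast_eq_natCast_iff', Nat.mod_eq_of_lt (by omega), Nat.mod_eq_of_lt (by omega)]
      omega
    obtain ⟨h1, h2, h3⟩ := hg _ _ hne
    rw [queenPrefix_succ, show k + 1 + d = k + (d + 1) by omega]
    simp only [queenFits, Bool.and_eq_true, Bool.not_eq_true', ih (d + 1) (by omega), and_true]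
    refine ⟨⟨?_, ?_⟩, ?_⟩
    · rw [← Bool.not_eq_true, Nat.beq_eq]
      exact fun H => h1 (ZMod.val_injective _ H)
    · rw [← Bool.not_eq_true, Nat.beq_eq]
      refine val_add_natCast_mod_ne fun H => h2 ?_
      rw [← H]; push_cast; ring
    · rw [← Bool.not_eq_true, Nat.beq_eq]
      refine val_add_natCast_mod_ne fun H => h3 ?_
      rw [← H]; push_cast; ring

theorem exists_queenPrefix_eq {g : ZMod 11 → ZMod 11}
    (hg : ∀ a b, a ≠ b → g a ≠ g b ∧ g a + a ≠ g b + b ∧ g a - a ≠ g b - b) (n : ℕ) :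
    ∀ k, k + n = 11 → queenSearch n (queenPrefix g k) = true →
      ∃ c, queenPrefix g 11 = (List.range 11).reverse.map fun i => (c * i) % 11 := by
  induction n with
  | zero =>
    intro k hk h
    obtain rfl : k = 11 := by omega
    simp only [queenSearch, List.any_eq_true, beq_iff_eq] at h
    obtain ⟨c, -, hc⟩ := h
    exact ⟨c, hc⟩
  | succ n ih =>
    intro k hk h
    simp only [queenSearch, List.all_eq_true] at h
    have hv := h (g (k : ZMod 11)).val (List.mem_range.2 (ZMod.val_lt _))
    have hfit := queenFits_queenPrefix hg k 0 (by omega)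
    simp only [add_zero, zero_add] at hfit
    rw [hfit] at hv
    refine ih (k + 1) (by omega) ?_
    rw [queenPrefix_succ]
    simpa using hv

/-- All solutions of the toroidal 11-queens problem are affine. -/
theorem exists_slope_of_queens (g : ZMod 11 → ZMod 11)
    -- The three inequalities say that no two queens share a row or a wrapped diagonal.
    (hg : ∀ a b, a ≠ b → g a ≠ g b ∧ g a + a ≠ g b + b ∧ g a - a ≠ g b - b) :
    ∃ s, ∀ a, g a = g 0 + a * s := by
  -- Subtracting `g 0` puts the first queen in row 0, the root `[0]` of the search; 10 columns
  -- remain.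
  obtain ⟨c, hc⟩ := exists_queenPrefix_eq (g := fun a => g a - g 0) (by
    intro a b hab
    obtain ⟨h1, h2, h3⟩ := hg a b hab
    refine ⟨fun H => h1 ?_, fun H => h2 ?_, fun H => h3 ?_⟩
    · linear_combination H
    · linear_combination H
    · linear_combination H) 10 1 rfl (by
      simpa [queenPrefix] using queenSearch_eq_true)
  refine ⟨c, fun a => ?_⟩
  unfold queenPrefix at hc
  have := (List.map_inj_left.1 hc) a.val (by simpa using ZMod.val_lt a)
  have := congrArg (Nat.cast : ℕ → ZMod 11) this
  simp at this
  linear_combination this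

/-! ### From crosses to integer points -/

/-- The centre and the `2n` neighbours of the centre of a cross, with coordinates in `R`. -/
def crossVec (R : Type*) [Ring R] {n : ℕ} : Option (Fin n × Bool) → Fin n → R
  | none => 0
  | some (i, true) => Pi.single i 1
  | some (i, false) => -Pi.single i 1

theorem mem_cross_iff {n : ℕ} {c x : EuclideanSpace ℝ (Fin n)} :
    x ∈ cross c ↔ ∃ o : Option (Fin n × Bool), x ∈ unitCube (c + WithLp.toLp 2 (crossVec ℝ o)) := by
  simp only [cross, Set.mem_union, Set.mem_iUnion, Option.exists, Prod.exists, Bool.exists_bool]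
  have h0 : (WithLp.toLp 2 (crossVec ℝ (none : Option (Fin n × Bool)))) = 0 := by
    ext; simp [crossVec]
  have h1 : ∀ i : Fin n, WithLp.toLp 2 (crossVec ℝ (some (i, true))) =
    EuclideanSpace.single i (1 : ℝ) := fun i => by ext; simp [crossVec, Pi.single_apply]
  have h2 : ∀ i : Fin n, WithLp.toLp 2 (crossVec ℝ (some (i, false))) =
    -EuclideanSpace.single i (1 : ℝ) := fun i => by ext; simp [crossVec, Pi.single_apply]
  simp only [h0, h1, h2, add_zero, ← sub_eq_add_neg]
  refine or_congr Iff.rfl (exists_congr fun i => or_comm)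

theorem mem_interior_unitCube {n : ℕ} (c : EuclideanSpace ℝ (Fin n)) :
    c ∈ interior (unitCube c) := by
  rw [mem_interior]
  refine ⟨Metric.ball c (1 / 2), fun x hx i => ?_, Metric.isOpen_ball,
    Metric.mem_ball_self (by norm_num)⟩
  have h1 : ‖(x - c) i‖ ≤ ‖x - c‖ := PiLp.norm_apply_le (x - c) i
  rw [Metric.mem_ball, dist_eq_norm] at hx
  simpa using h1.trans hx.le

/-- The point of Euclidean space with given integer coordinates. -/
def intPoint {n : ℕ} : (Fin n → ℤ) →ₗ[ℤ] EuclideanSpace ℝ (Fin n) where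
  toFun z := WithLp.toLp 2 fun i => (z i : ℝ)
  map_add' x y := by ext; simp
  map_smul' m x := by ext; simp

@[simp] theorem intPoint_apply {n : ℕ} (z : Fin n → ℤ) (i : Fin n) : intPoint z i = z i := rfl

theorem intPoint_injective {n : ℕ} : Function.Injective (intPoint (n := n)) := by
  intro x y h
  ext i
  have := congrArg (fun v : EuclideanSpace ℝ (Fin n) => v i) h
  simpa using this

theorem intPoint_crossVec {n : ℕ} (o : Option (Fin n × Bool)) :
    intPoint (crossVec ℤ o) = WithLp.toLp 2 (crossVec ℝ o) := by
  ext i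
  rcases o with _ | ⟨j, _ | _⟩
  · simp [crossVec]
  all_goals by_cases h : i = j <;> simp [crossVec, h]

theorem eq_of_intPoint_mem_unitCube {n : ℕ} {x y : Fin n → ℤ}
    (h : intPoint x ∈ unitCube (intPoint y)) : x = y := by
  ext i
  have := h i
  simp only [intPoint_apply] at this
  have h2 : |((x i - y i : ℤ) : ℝ)| < 1 := by push_cast; linarith
  rw [← Int.cast_abs, ← Int.cast_one, Int.cast_lt, Int.abs_lt_one_iff] at h2
  omega

theorem crossVec_injective (R : Type*) [Ring R] [Nontrivial R] (h2 : (2 : R) ≠ 0) {n : ℕ} :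
    Function.Injective (crossVec R (n := n)) := by
  have h11 : (1 : R) ≠ -1 := fun h => h2 (by rw [← one_add_one_eq_two]; nth_rw 1 [h]; simp)
  rintro (_ | ⟨i, b⟩) (_ | ⟨j, b'⟩) h
  · rfl
  · have hj := congrFun h j
    cases b' <;> simp [crossVec] at hj
  · have hi := congrFun h i
    cases b <;> simp [crossVec] at hi
  · have hj := congrFun h j
    by_cases hij : j = i
    · subst hij
      cases b <;> cases b' <;> simp [crossVec, h11, h11.symm] at hj ⊢
    · cases b <;> cases b' <;> simp [crossVec, hij] at hj

theorem crossVec_neg (R : Type*) [Ring R] {n : ℕ} (o : Option (Fin n × Bool)) :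
    ∃ o', crossVec R o' = -crossVec R o := by
  rcases o with _ | ⟨j, _ | _⟩
  · exact ⟨none, by simp [crossVec]⟩
  · exact ⟨some (j, true), by simp [crossVec]⟩
  · exact ⟨some (j, false), by simp [crossVec]⟩

/-- An integer point in a unit cube with integer centre is that centre, so covering yields a cross
vector. Two would put the point in the interiors of two distinct crosses. -/
theorem IsCrossZTiling.existsUnique {n : ℕ} {T : Set (EuclideanSpace ℝ (Fin n))}
    (hT : IsCrossZTiling T) (z : Fin n → ℤ) :
    ∃! o : Option (Fin n × Bool), intPoint (z + crossVec ℤ o) ∈ T := by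
  apply existsUnique_of_exists_of_unique
  · have hz : intPoint z ∈ ⋃ c ∈ T, cross c := hT.cover ▸ Set.mem_univ _
    simp only [Set.mem_iUnion, mem_cross_iff, exists_prop] at hz
    obtain ⟨c, hc, o, ho⟩ := hz
    choose y hy using hT.integral c hc
    obtain rfl : c = intPoint y := by ext i; simp [hy]
    rw [← intPoint_crossVec, ← map_add] at ho
    have := eq_of_intPoint_mem_unitCube ho
    obtain ⟨o', ho'⟩ := crossVec_neg ℤ o
    refine ⟨o', ?_⟩
    rwa [this, ho', add_neg_cancel_right]
  · intro o o' ho ho'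
    have key : ∀ o : Option (Fin n × Bool),
        intPoint z ∈ interior (cross (intPoint (z + crossVec ℤ o))) := by
      intro o
      obtain ⟨p, hp⟩ := crossVec_neg ℤ o
      have hsub : unitCube (intPoint z) ⊆ cross (intPoint (z + crossVec ℤ o)) := fun x hx => by
        refine mem_cross_iff.2 ⟨p, ?_⟩
        rwa [← intPoint_crossVec, ← map_add, hp, add_neg_cancel_right]
      exact interior_mono hsub (mem_interior_unitCube _)
    by_contra hne
    have hne' : intPoint (z + crossVec ℤ o) ≠ intPoint (z + crossVec ℤ o') := fun h =>
      hne (crossVec_injective ℤ (by norm_num) (add_left_cancel (intPoint_injective h)))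
    exact Set.disjoint_left.1 (hT.disjoint ho ho' hne') (key o) (key o')

/-! ### Periodicity and dilation -/

open Classical in
theorem natCast_card_filter_shift_eq {G ι : Type*} [AddCommGroup G] [Fintype ι] (q : ℕ)
    [Fact q.Prime] {a : ι → G} {S : Set G} (h : ∀ x, ∃! i, x + a i ∈ S) (x : G) :
    ((Finset.univ.filter fun i => x + q • a i ∈ S).card : ZMod q) =
      (Fintype.card ι : ZMod q) ^ (q - 1) := by
  rw [← Finset.sum_boole]
  refine sum_shift_pow_char q a (fun y => if y ∈ S then 1 else 0) (fun y => ?_) x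
  rw [Finset.sum_boole, (Fintype.existsUnique_iff_card_one _).1 (h y), Nat.cast_one]

/-- The count of good indices is 0 modulo q, is positive because of `i₀`, and is at most q; so it is
q. -/
theorem add_prime_smul_mem {G ι : Type*} [AddCommGroup G] [Fintype ι] (q : ℕ) [hq : Fact q.Prime]
    (hι : Fintype.card ι = q) {a : ι → G} {S : Set G} (h : ∀ x, ∃! i, x + a i ∈ S) {i₀ : ι}
    (h0 : a i₀ = 0) {x : G} (hx : x ∈ S) (i : ι) : x + q • a i ∈ S := by
  classical
  have hc := natCast_card_filter_shift_eq q h x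
  rw [hι, CharP.cast_eq_zero (ZMod q) q, zero_pow (Nat.sub_ne_zero_of_lt hq.out.one_lt),
    ZMod.natCast_eq_zero_iff] at hc
  have hpos : 0 < (Finset.univ.filter fun i => x + q • a i ∈ S).card :=
    Finset.card_pos.2 ⟨i₀, by simp [h0, hx]⟩
  have hle := Nat.le_of_dvd hpos hc
  have huniv : (Finset.univ.filter fun i => x + q • a i ∈ S) = Finset.univ :=
    Finset.eq_univ_of_card _ (le_antisymm (Finset.card_le_univ _) (hι ▸ hle))
  exact (Finset.filter_eq_self.1 huniv) i (Finset.mem_univ i)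

/-- The count of good indices is odd, hence at least 1 at every point. Its total over the finite
group is unchanged by dilation, so its average is 1 and equality holds everywhere. -/
theorem existsUnique_two_smul {G ι : Type*} [AddCommGroup G] [Fintype G] [Fintype ι]
    (hι : Odd (Fintype.card ι)) {a : ι → G} {S : Set G} (h : ∀ x, ∃! i, x + a i ∈ S) (x : G) :
    ∃! i, x + 2 • a i ∈ S := by
  classical
  have hpos : ∀ y, 1 ≤ (Finset.univ.filter fun i => y + 2 • a i ∈ S).card := by
    intro y
    rw [Nat.one_le_iff_ne_zero]
    intro H
    have := natCast_card_filter_shift_eq 2 h y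
    rw [H, ZMod.natCast_eq_one_iff_odd.2 hι] at this
    simp at this
  have hcount : ∀ b : ι → G, ∑ y, (Finset.univ.filter fun i => y + b i ∈ S).card =
      Fintype.card ι * ∑ y, if y ∈ S then 1 else 0 := by
    intro b
    simp only [Finset.card_filter]
    rw [Finset.sum_comm]
    have : ∀ i, ∑ y, (if y + b i ∈ S then 1 else 0) = ∑ y, if y ∈ S then 1 else 0 := fun i =>
      Equiv.sum_comp (Equiv.addRight (b i)) fun y => if y ∈ S then 1 else 0
    simp [this]
  have hsum : ∑ _y : G, 1 = ∑ y, (Finset.univ.filter fun i => y + 2 • a i ∈ S).card := by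
    rw [hcount, ← hcount a]
    exact Finset.sum_congr rfl fun y _ => ((Fintype.existsUnique_iff_card_one _).1 (h y)).symm
  rw [Fintype.existsUnique_iff_card_one]
  exact ((Finset.sum_eq_sum_iff_of_le fun y _ => hpos y).1 hsum x (Finset.mem_univ x)).symm

theorem existsUnique_two_pow_smul {G ι : Type*} [AddCommGroup G] [Fintype G] [Fintype ι]
    (hι : Odd (Fintype.card ι)) {a : ι → G} {S : Set G} (h : ∀ x, ∃! i, x + a i ∈ S) (m : ℕ) :
    ∀ x, ∃! i, x + 2 ^ m • a i ∈ S := by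
  induction m with
  | zero => simpa using h
  | succ m ih =>
    intro x
    have := existsUnique_two_smul hι ih x
    simpa only [smul_smul, pow_succ'] using this

/-- 2 is a primitive root modulo 11, so repeated doubling reaches every nonzero dilation. -/
theorem exists_two_pow_eq (k : ZMod 11) (hk : k ≠ 0) : ∃ m : ℕ, (2 : ZMod 11) ^ m = k := by
  have : ∀ k : ZMod 11, k ≠ 0 → ∃ m : Fin 10, (2 : ZMod 11) ^ (m : ℕ) = k := by decide
  obtain ⟨m, hm⟩ := this k hk
  exact ⟨m, hm⟩

theorem card_crossIndex : Fintype.card (Option (Fin 5 × Bool)) = 11 := by simp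

/-! ### Tilings modulo 11 -/

/-- A tiling of `(ZMod 11)⁵` by crosses. -/
def IsModCrossTiling (S : Set (Fin 5 → ZMod 11)) : Prop :=
  ∀ x, ∃! o, x + crossVec (ZMod 11) o ∈ S

namespace IsModCrossTiling

variable {S : Set (Fin 5 → ZMod 11)}

theorem existsUnique_smul (hS : IsModCrossTiling S) {k : ZMod 11} (hk : k ≠ 0)
    (x : Fin 5 → ZMod 11) : ∃! o, x + k • crossVec (ZMod 11) o ∈ S := by
  obtain ⟨m, rfl⟩ := exists_two_pow_eq k hk
  have := existsUnique_two_pow_smul (by rw [card_crossIndex]; decide) hS m x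
  convert this using 4
  rw [← Nat.cast_smul_eq_nsmul (ZMod 11)]
  simp

theorem eq_zero_of_add_single (hS : IsModCrossTiling S) {x : Fin 5 → ZMod 11} (hx : x ∈ S)
    {i : Fin 5} {k : ZMod 11} (h : x + Pi.single i k ∈ S) : k = 0 := by
  by_contra hk
  have := (hS.existsUnique_smul hk x).unique (y₁ := none) (y₂ := some (i, true))
    (by simpa [crossVec] using hx) (by simpa [crossVec, ← Pi.single_smul] using h)
  simp at this

theorem eq_zero_of_add_single_sub (hS : IsModCrossTiling S) {x : Fin 5 → ZMod 11} (hx : x ∈ S)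
    {i j : Fin 5} (hij : i ≠ j) {k : ZMod 11} (h : x + Pi.single i k - Pi.single j k ∈ S) :
    k = 0 := by
  by_contra hk
  have := (hS.existsUnique_smul hk (x - Pi.single j k)).unique (y₁ := some (j, true))
    (y₂ := some (i, true))
    (by simpa [crossVec, ← Pi.single_smul] using hx)
    (by simpa [crossVec, ← Pi.single_smul, sub_add_eq_add_sub] using h)
  simp [hij.symm] at this

theorem eq_zero_of_add_single_add (hS : IsModCrossTiling S) {x : Fin 5 → ZMod 11} (hx : x ∈ S)
    {i j : Fin 5} {k : ZMod 11} (h : x + Pi.single i k + Pi.single j k ∈ S) :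
    k = 0 := by
  by_contra hk
  have := (hS.existsUnique_smul hk (x + Pi.single j k)).unique (y₁ := some (j, false))
    (y₂ := some (i, true))
    (by simpa [crossVec, ← Pi.single_smul] using hx)
    (by simpa [crossVec, ← Pi.single_smul, add_right_comm] using h)
  simp at this

theorem existsUnique_add_single (hS : IsModCrossTiling S) (i : Fin 5) (x : Fin 5 → ZMod 11) :
    ∃! t, x + Pi.single i t ∈ S := by
  classical
  let φ : S × Option (Fin 5 × Bool) → Fin 5 → ZMod 11 := fun p => p.1.1 - crossVec (ZMod 11) p.2
  have hφ : Function.Bijective φ := by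
    constructor
    · rintro ⟨⟨y, hy⟩, o⟩ ⟨⟨y', hy'⟩, o'⟩ h
      have h' : y - crossVec _ o = y' - crossVec _ o' := h
      obtain rfl : o = o' := (hS (y - crossVec _ o)).unique (by simpa using hy)
        (by simpa [h'] using hy')
      simpa using h'
    · intro y
      obtain ⟨o, ho, -⟩ := hS y
      exact ⟨(⟨_, ho⟩, o), by simp [φ]⟩
  let ψ : S × ZMod 11 → Fin 5 → ZMod 11 := fun p => p.1.1 - Pi.single i p.2
  have hψ : Function.Injective ψ := by
    rintro ⟨⟨y, hy⟩, t⟩ ⟨⟨y', hy'⟩, t'⟩ h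
    have h' : y - Pi.single i t = y' - Pi.single i t' := h
    have ht : t' - t = 0 := hS.eq_zero_of_add_single hy (i := i) (by
      rwa [Pi.single_sub, add_sub_left_comm, h', add_sub_cancel])
    obtain rfl := sub_eq_zero.1 ht
    simpa using h'
  -- A line in direction `i` has 11 points, as many as a cross, so packing by lines fills the space
  -- exactly as the crosses do.
  have hψ' : Function.Bijective ψ := by
    rw [Fintype.bijective_iff_injective_and_card]
    refine ⟨hψ, ?_⟩
    rw [← Fintype.card_of_bijective hφ, Fintype.card_prod, Fintype.card_prod, card_crossIndex,
      ZMod.card]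
  obtain ⟨⟨⟨y, hy⟩, t⟩, rfl⟩ := hψ'.surjective x
  refine ⟨t, by simpa [ψ] using hy, fun t' ht' => ?_⟩
  refine sub_eq_zero.1 (hS.eq_zero_of_add_single hy (i := i) ?_)
  rw [Pi.single_sub]
  convert ht' using 1
  simp only [ψ]
  abel

end IsModCrossTiling

/-! ### Affine structure -/

/-- A function that is affine with nonzero slope along every line parallel to a coordinate axis is
affine. -/
theorem exists_affine_of_slopes {ι F : Type*} [Fintype ι] [DecidableEq ι] [Field F]
    {f : (ι → F) → F}
    (h : ∀ x i, ∃ s, s ≠ 0 ∧ ∀ a, f (x + Pi.single i a) = f x + a * s) :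
    ∃ s : ι → F, ∀ x, f x = f 0 + ∑ i, x i * s i := by
  choose s hs0 hs using h
  have hconst : ∀ x i j t, s (x + Pi.single j t) i = s x i := by
    intro x i j t
    by_contra hne
    have e : ∀ t a, t * s x j + a * s (x + Pi.single j t) i =
        a * s x i + t * s (x + Pi.single i a) j := by
      intro t a
      have h1 := hs (x + Pi.single j t) i a
      have h2 := hs (x + Pi.single i a) j t
      rw [add_right_comm, h2, hs, hs] at h1
      linear_combination -h1
    have e1 := e t 1
    have hc : s (x + Pi.single i 1) j - s x j ≠ 0 := by
      intro H
      apply hne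
      linear_combination e1 + t * H
    -- By `e1` the slope in direction `i` at `x + t eⱼ` is `s x i` plus t times the denominator.
    -- This t makes that slope vanish, against `hs0`.
    have e2 := e (-s x i / (s (x + Pi.single i 1) j - s x j)) 1
    apply hs0 (x + Pi.single j (-s x i / (s (x + Pi.single i 1) j - s x j))) i
    have e3 := div_mul_cancel₀ (-s x i) hc
    linear_combination e2 + e3
  refine ⟨s 0, fun x => ?_⟩
  have key : ∀ A : Finset ι, (∀ i, s (∑ j ∈ A, Pi.single j (x j)) i = s 0 i) ∧
      f (∑ j ∈ A, Pi.single j (x j)) = f 0 + ∑ j ∈ A, x j * s 0 j := by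
    intro A
    induction A using Finset.induction_on with
    | empty => simp
    | insert j A hj ih =>
      rw [Finset.sum_insert hj, Finset.sum_insert hj, add_comm (Pi.single j _ : ι → F)]
      refine ⟨fun i => by rw [hconst, ih.1], ?_⟩
      rw [hs, ih.2, ih.1]
      ring
  have := (key Finset.univ).2
  rwa [Finset.univ_sum_single] at this

theorem IsModCrossTiling.exists_eq {S : Set (Fin 5 → ZMod 11)} (hS : IsModCrossTiling S) :
    ∃ (c : ZMod 11) (s : Fin 5 → ZMod 11), ∀ x, x ∈ S ↔ c + ∑ i, x i * s i = 0 := by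
  choose f hf hfu using hS.existsUnique_add_single 0
  beta_reduce at hf hfu
  have : Fact (Nat.Prime 11) := ⟨by norm_num⟩
  have hslope : ∀ x i, ∃ s, s ≠ 0 ∧ ∀ a, f (x + Pi.single i a) = f x + a * s := by
    intro x i
    rcases eq_or_ne i 0 with rfl | hi
    -- Moving the base point by `a` along the direction over which `S` is a graph lowers the height
    -- by `a`.
    · refine ⟨-1, neg_ne_zero.2 one_ne_zero, fun a => (hfu _ _ ?_).symm⟩
      have := hf x
      rwa [add_assoc, ← Pi.single_add, show a + (f x + a * -1) = f x by ring]
    · have hq : ∀ a b, a ≠ b → f (x + Pi.single i a) ≠ f (x + Pi.single i b) ∧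
          f (x + Pi.single i a) + a ≠ f (x + Pi.single i b) + b ∧
          f (x + Pi.single i a) - a ≠ f (x + Pi.single i b) - b := by
        intro a b hab
        have ha := hf (x + Pi.single i a)
        have hb := hf (x + Pi.single i b)
        have hab' : b - a ≠ 0 := sub_ne_zero.2 hab.symm
        refine ⟨fun H => hab' ?_, fun H => hab' ?_, fun H => hab' ?_⟩
        · refine hS.eq_zero_of_add_single ha (i := i) ?_
          convert hb using 1
          rw [H, Pi.single_sub]
          abel
        · refine hS.eq_zero_of_add_single_sub ha hi ?_
          convert hb using 1
          rw [← sub_eq_iff_eq_add.2 H.symm, Pi.single_sub, Pi.single_sub, Pi.single_sub,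
            Pi.single_add]
          abel
        · refine hS.eq_zero_of_add_single_add ha (i := i) (j := 0) ?_
          convert hb using 1
          rw [sub_eq_iff_eq_add.1 H.symm, Pi.single_sub, Pi.single_sub, Pi.single_add,
            Pi.single_sub]
          abel
      obtain ⟨s, hs⟩ := exists_slope_of_queens (fun a => f (x + Pi.single i a)) hq
      simp only [Pi.single_zero, add_zero] at hs
      refine ⟨s, ?_, hs⟩
      rintro rfl
      refine (hq 0 1 zero_ne_one).1 ?_
      rw [hs, hs]
      simp
  obtain ⟨s, hs⟩ := exists_affine_of_slopes hslope
  refine ⟨f 0, s, fun x => ?_⟩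
  rw [← hs]
  constructor
  · intro hx
    exact (hfu x 0 (by simpa using hx)).symm
  · intro hx
    simpa [hx] using hf x

/-! ### Lifting back to integer points -/

theorem add_smul_mem_of_existsUnique {S : Set (Fin 5 → ℤ)}
    (hS : ∀ z, ∃! o, z + crossVec ℤ o ∈ S) {z : Fin 5 → ℤ} (hz : z ∈ S) (w : Fin 5 → ℤ) :
    z + (11 : ℤ) • w ∈ S := by
  have : Fact (Nat.Prime 11) := ⟨by norm_num⟩
  have hadd : ∀ z ∈ S, ∀ o, z + 11 • crossVec ℤ o ∈ S := fun z hz o =>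
    add_prime_smul_mem 11 card_crossIndex hS (i₀ := none) rfl hz o
  let H : AddSubgroup (Fin 5 → ℤ) :=
    { carrier := {w | ∀ z, z + w ∈ S ↔ z ∈ S}
      zero_mem' := by simp
      add_mem' := fun {u v} hu hv z => by rw [← add_assoc, hv, hu]
      neg_mem' := fun {u} hu z => by rw [← hu, neg_add_cancel_right] }
  have hsingle : ∀ i, (11 : ℤ) • Pi.single i (1 : ℤ) ∈ H := by
    intro i z
    refine ⟨fun h => ?_, fun h => ?_⟩
    · simpa [crossVec] using hadd _ h (some (i, false))
    · simpa [crossVec] using hadd _ h (some (i, true))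
  have hw : (11 : ℤ) • w = ∑ i, w i • ((11 : ℤ) • (Pi.single i (1 : ℤ) : Fin 5 → ℤ)) := by
    simp_rw [smul_comm (w _) (11 : ℤ), ← Finset.smul_sum, ← Pi.single_smul, smul_eq_mul, mul_one,
      Finset.univ_sum_single]
  have : (11 : ℤ) • w ∈ H := hw ▸ H.sum_mem fun i _ => H.zsmul_mem (hsingle i) _
  exact (this z).2 hz

theorem intCast_comp_crossVec {R : Type*} [Ring R] {n : ℕ} (o : Option (Fin n × Bool)) (i : Fin n) :
    ((crossVec ℤ o i : ℤ) : R) = crossVec R o i := by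
  rcases o with _ | ⟨j, _ | _⟩
  · simp [crossVec]
  all_goals by_cases h : i = j <;> simp [crossVec, h]

theorem exists_mem_iff_of_existsUnique {S : Set (Fin 5 → ℤ)}
    (hS : ∀ z, ∃! o, z + crossVec ℤ o ∈ S) :
    ∃ (c : ZMod 11) (s : Fin 5 → ZMod 11), ∀ z, z ∈ S ↔ c + ∑ i, (z i : ZMod 11) * s i = 0 := by
  let π : (Fin 5 → ℤ) → Fin 5 → ZMod 11 := fun z i => (z i : ZMod 11)
  have hπ : ∀ z, π z ∈ π '' S ↔ z ∈ S := by
    refine fun z => ⟨?_, fun h => ⟨z, h, rfl⟩⟩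
    rintro ⟨y, hy, hyz⟩
    have hdvd : ∀ i, (11 : ℤ) ∣ z i - y i := fun i =>
      (ZMod.intCast_eq_intCast_iff_dvd_sub _ _ 11).1 (congrFun hyz i)
    choose w hw using hdvd
    have : z = y + (11 : ℤ) • w := by
      ext i
      simp [← hw]
    rw [this]
    exact add_smul_mem_of_existsUnique hS hy w
  have hmod : IsModCrossTiling (π '' S) := by
    intro x
    choose z hz using fun i => ZMod.intCast_surjective (x i)
    have : ∀ o, x + crossVec (ZMod 11) o = π (z + crossVec ℤ o) := by
      intro o
      ext i
      simp [π, hz, intCast_comp_crossVec]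
    simp only [this, hπ]
    exact hS z
  obtain ⟨c, s, h⟩ := hmod.exists_eq
  exact ⟨c, s, fun z => by rw [← hπ, h]⟩

/-! ### The lattice and the conclusion -/

/-- The integer vectors orthogonal to `s` modulo `m`. -/
def modKer {n : ℕ} (m : ℕ) (s : Fin n → ZMod m) : Submodule ℤ (Fin n → ℤ) where
  carrier := {z | ∑ i, (z i : ZMod m) * s i = 0}
  zero_mem' := by simp
  add_mem' := fun {x y} hx hy => by
    simp only [Set.mem_ofPred_eq, Pi.add_apply, Int.cast_add, add_mul, Finset.sum_add_distrib] at *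
    rw [hx, hy, add_zero]
  smul_mem' := fun k x hx => by
    simp only [Set.mem_ofPred_eq, Pi.smul_apply, smul_eq_mul, Int.cast_mul, mul_assoc,
      ← Finset.mul_sum] at *
    rw [hx, mul_zero]

theorem mem_modKer {n m : ℕ} {s : Fin n → ZMod m} {z : Fin n → ℤ} :
    z ∈ modKer m s ↔ ∑ i, (z i : ZMod m) * s i = 0 := Iff.rfl

theorem one_le_dist_intPoint {n : ℕ} {x y : Fin n → ℤ} (h : x ≠ y) :
    1 ≤ dist (intPoint x) (intPoint y) := by
  obtain ⟨i, hi⟩ := Function.ne_iff.1 h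
  have h1 : ‖(intPoint x - intPoint y) i‖ ≤ ‖intPoint x - intPoint y‖ := PiLp.norm_apply_le _ i
  rw [dist_eq_norm]
  refine le_trans ?_ h1
  simp only [PiLp.sub_apply, intPoint_apply, Real.norm_eq_abs]
  exact_mod_cast Int.one_le_abs (sub_ne_zero.2 hi)

theorem isLatticeSet_image_modKer {n m : ℕ} [NeZero m] (s : Fin n → ZMod m) :
    IsLatticeSet (intPoint '' (modKer m s : Set (Fin n → ℤ))) := by
  have hdisc : DiscreteTopology ((modKer m s).map intPoint) := by
    refine DiscreteTopology.of_forall_le_dist one_pos ?_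
    rintro ⟨_, x, _, rfl⟩ ⟨_, y, _, rfl⟩ hne
    exact one_le_dist_intPoint fun h => hne (by simp [h])
  refine ⟨(modKer m s).map intPoint, ⟨hdisc, ⟨?_⟩⟩, by simp⟩
  rw [eq_top_iff]
  intro x _
  -- The vectors m·eᵢ lie in the kernel whatever `s` is, and they already span.
  have hsingle : ∀ i : Fin n, EuclideanSpace.single i (m : ℝ) ∈
      Submodule.span ℝ (((modKer m s).map intPoint : Submodule ℤ (EuclideanSpace ℝ (Fin n))) :
        Set (EuclideanSpace ℝ (Fin n))) := by
    intro i
    refine Submodule.subset_span ⟨Pi.single i (m : ℤ), ?_, ?_⟩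
    · refine mem_modKer.2 (Finset.sum_eq_zero fun j _ => ?_)
      by_cases h : j = i
      · subst h; simp
      · simp [h]
    · ext j
      by_cases h : j = i <;> simp [h]
  have hx : x = ∑ i, (x i / m) • EuclideanSpace.single i (m : ℝ) := by
    ext j
    have hm : (m : ℝ) ≠ 0 := Nat.cast_ne_zero.2 (NeZero.ne m)
    simp [Finset.sum_apply, Pi.single_apply, hm]
  rw [hx]
  exact Submodule.sum_mem _ fun i _ => Submodule.smul_mem _ _ (hsingle i)

theorem mainTheorem5 (T : Set (EuclideanSpace ℝ (Fin 5))) (hT : IsCrossZTiling T) :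
    IsLatticeCrossTiling T ∧
      (0 ∈ T → IsLatticeSet T ∧ ∀ w ∈ T, ∀ z ∈ T, w - z ∈ T) := by
  obtain ⟨c, s, hs⟩ := exists_mem_iff_of_existsUnique (S := {z | intPoint z ∈ T})
    fun z => hT.existsUnique z
  simp only [Set.mem_ofPred_eq] at hs
  have hint : ∀ x ∈ T, ∃ z, intPoint z = x := by
    intro x hx
    choose z hz using hT.integral x hx
    exact ⟨z, by ext i; simp [hz]⟩
  obtain ⟨o, ho, -⟩ := hT.existsUnique 0
  rw [zero_add] at ho
  have hL : ∀ v, intPoint v ∈ T →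
      T = {x | ∃ l ∈ intPoint '' (modKer 11 s : Set (Fin 5 → ℤ)), x = intPoint v + l} := by
    intro v hv
    have hv' := (hs v).1 hv
    have hadd : ∀ z, intPoint (v + z) ∈ T ↔ z ∈ modKer 11 s := by
      intro z
      rw [hs, mem_modKer]
      simp only [Pi.add_apply, Int.cast_add, add_mul, Finset.sum_add_distrib]
      rw [← add_assoc, hv', zero_add]
    ext x
    constructor
    · intro hx
      obtain ⟨z, rfl⟩ := hint x hx
      refine ⟨_, ⟨z - v, (hadd _).1 (by simpa using hx), rfl⟩, by simp⟩
    · rintro ⟨_, ⟨z, hz, rfl⟩, rfl⟩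
      rw [← map_add]
      exact (hadd z).2 hz
  refine ⟨⟨hT.toIsCrossTiling, _, _, isLatticeSet_image_modKer s, hL _ ho⟩, fun h0 => ?_⟩
  have hT0 : T = intPoint '' (modKer 11 s : Set (Fin 5 → ℤ)) :=
    (hL 0 (by simpa using h0)).trans (by ext x; simp [eq_comm])
  refine ⟨hT0 ▸ isLatticeSet_image_modKer s, ?_⟩
  rw [hT0]
  rintro _ ⟨x, hx, rfl⟩ _ ⟨y, hy, rfl⟩
  exact ⟨x - y, sub_mem hx hy, map_sub _ _ _⟩
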